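/- Let $X$ be a real or complex Banach space and let $I=\{(i,j)\in\mathbb N\times\mathbb N: i\le j\}$ (it is immaterial whether $\mathbb N$ starts with $0$ or $1$), ordered by the reverse lexicographic order: $(i,j)<_{r\ell}(i',j')$ iff $j<j'$, or $j=j'$ and $i<i'$. An array in $X$ is a family $(x_{i,j})_{(i,j)\in I}$ in $X$ each of whose rows $(x_{i,j})_{j\ge i}$ is a weakly null sequence that is seminormalized, i.e. $0<\inf_{j\ge i}\|x_{i,j}\|\le\sup_{j\ge i}\|x_{i,j}\|<\infty$. An array is regular if, enumerated in the order $<_{r\ell}$, it is a basic sequence, i.e. a Schauder basis of its closed linear span. A subarray of $(x_{i,j})_{(i,j)\in I}$ is an array $(y_{i,j})_{(i,j)\in I}$ such that $\{y_{i,j}:j\ge i\}\subseteq\{x_{i,j}:j\ge i\}$ for every $i$ and such that there is a strictly $<_{r\ell}$-increasing map $H:I\to I$ with $y_{i,j}=x_{H(i,j)}$ for all $(i,j)\in I$. Theorem. Let $(x_{i,j})_{(i,j)\in I}$ be a regular array in $X$, let $(M_j)_{j\in\mathbb N}\subseteq\mathbb N$ be an increasing (not necessarily strictly) sequence, and let $\varepsilon>0$.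 Then there is a regular subarray $(y_{i,j})_{(i,j)\in I}$ of $(x_{i,j})_{(i,j)\in I}$ such that for all finitely supported scalars $(a_{i,j})_{(i,j)\in I}$, all $k_0\in\mathbb N$ and all finite non-empty $F\subseteq\mathbb N$ with $|F|\le M_{\min F}$ and $k_0\le\min F$, $$\Big\|\sum_{(i,j)\in I}a_{i,j}\,y_{i,j}\Big\|\ \ge\ \frac1{2+\varepsilon}\,\Big\|\sum_{j\in F}a_{k_0,j}\,y_{k_0,j}\Big\| .$$ -/

import Mathlib

open Filter Topology

/-- The triangular index set `I = {(i, j) : i ≤ j}` of arrays (`i` is the row, `j` the column).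
Indices start at `0`. -/
def triIndex : Set (ℕ × ℕ) := {p | p.1 ≤ p.2}

/-- The (strict) reverse lexicographic order on `ℕ × ℕ`: compare the second coordinates first. -/
def rlLT (p q : ℕ × ℕ) : Prop := p.2 < q.2 ∨ (p.2 = q.2 ∧ p.1 < q.1)

/-- The successor of an element of `triIndex` in the reverse lexicographic order: go down the
column, then jump to the top of the next column. -/
def rlSucc (p : ℕ × ℕ) : ℕ × ℕ := if p.1 < p.2 then (p.1 + 1, p.2) else (0, p.2 + 1)

/-- The enumeration `(0,0), (0,1), (1,1), (0,2), (1,2), (2,2), (0,3), …` of `triIndex` in the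
reverse lexicographic order. -/
def rlEnum (n : ℕ) : ℕ × ℕ := rlSucc^[n] (0, 0)

section

variable (𝕜 : Type*) [RCLike 𝕜] {X : Type*} [NormedAddCommGroup X] [NormedSpace 𝕜 X]

/-- The sequence `u` is seminormalized: `0 < inf ‖u n‖ ≤ sup ‖u n‖ < ∞`. -/
def IsSeminormalized (u : ℕ → X) : Prop :=
  ∃ c C : ℝ, 0 < c ∧ ∀ n, c ≤ ‖u n‖ ∧ ‖u n‖ ≤ C

/-- The sequence `u` converges weakly to zero. -/
def IsWeaklyNull (u : ℕ → X) : Prop :=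
  ∀ f : StrongDual 𝕜 X, Tendsto (fun n => f (u n)) atTop (𝓝 0)

/-- The sequence `u` is basic: it is a Schauder basis of its closed linear span. -/
def IsBasicSequence (u : ℕ → X) : Prop :=
  ∃ b : SchauderBasis 𝕜 (Submodule.span 𝕜 (Set.range u)).topologicalClosure,
    ∀ n, ((b.basis n : (Submodule.span 𝕜 (Set.range u)).topologicalClosure) : X) = u n

/-- The family `x`, restricted to `triIndex`, is an array: every row `x (i, i), x (i, i + 1), …` is
a seminormalized weakly null sequence. The values of `x` off `triIndex` are irrelevant, here and
below. -/
def IsTriArray (x : ℕ × ℕ → X) : Prop :=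
  ∀ i, IsSeminormalized (fun k => x (i, i + k)) ∧ IsWeaklyNull 𝕜 (fun k => x (i, i + k))

/-- A regular array: an array which is a basic sequence in the reverse lexicographic order. -/
def IsRegularArray (x : ℕ × ℕ → X) : Prop :=
  IsTriArray 𝕜 x ∧ IsBasicSequence 𝕜 (fun n => x (rlEnum n))

/-- `y` is a subarray of `x`: `y` is an array, the terms of each row of `y` are among the terms of
the same row of `x`, and `y = x ∘ H` on `triIndex` for some map `H` of `triIndex` to itself that
preserves the reverse lexicographic order. -/
def IsSubarray (x y : ℕ × ℕ → X) : Prop :=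
  IsTriArray 𝕜 y ∧
  (∀ i, {v | ∃ j, i ≤ j ∧ y (i, j) = v} ⊆ {v | ∃ j, i ≤ j ∧ x (i, j) = v}) ∧
  ∃ H : ℕ × ℕ → ℕ × ℕ,
    (∀ p ∈ triIndex, H p ∈ triIndex) ∧
    (∀ p ∈ triIndex, ∀ q ∈ triIndex, rlLT p q → rlLT (H p) (H q)) ∧
    ∀ p ∈ triIndex, y p = x (H p)

end

/-!
Enumerate the index set in the reverse lexicographic order, the `n`-th index lying in row `r n`.
The subarray has `y n = x (r n, m n)` as its `n`-th vector, for a strictly increasing sequence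
`m`, so that the subarray conditions hold automatically and only the growth of `m` has to be
arranged.

By duality, the estimate follows if every functional `f` of norm at most one can be replaced by a
functional `g` of norm at most one with `g ≈ f` on the vectors of row `k₀` with column in `F`, and
`g ≈ 0` on all other vectors from the position `q` of `(k₀, min F)` on: then the norm of the sum
over `F` is almost dominated by the norm of the tail from `q` on, which is at most almost twice
the norm of the whole sum as soon as the initial projections are almost contractive
(`norm_sum_subset_le`).

The functionals `g` are prepared in advance as limit trees. Since `|F| ≤ M (min F)`, a number of
functionals depending only on `q` suffices to approximate the whole dual unit ball on the vectors
indexed by `F` (`exists_net_of_card_eq`), so for each `q` only finitely many functions `L`, from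
sets of `k` indices of the row to functionals, are needed. Each `L` is extended to smaller sets by
iterated weak* limits along a nonprincipal ultrafilter, the largest index tending to infinity
first (`exists_limit_tree`). If `m n` is chosen far enough out, then all functionals attached to
sets of earlier indices are small at the new vector, because the rows are weakly null, and
adjoining the new index to such a set hardly changes its functional at the earlier vectors
(`exists_selection`). Hence the functional `L S` is small at all chosen vectors outside `S`
(`norm_limit_tree_le`).

The initial projections are treated in Mazur's way: finite nets of functionals on the span of the
vectors already chosen are required to be small at all later vectors. The error terms involve the
largest coefficient, which is a difference of two partial sums, and are absorbed
(`norm_partial_sum_and_coeff_le`). Regularity of the subarray is then Grünblum's criterion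
(`isBasicSequence_of_norm_sum_le`).
-/

section

variable {𝕜 : Type*} [RCLike 𝕜] {X : Type*} [NormedAddCommGroup X] [NormedSpace 𝕜 X]

/-! ### Basic sequences from bounded partial sums -/

theorem linearCombination_eq_sum_range {Y : Type*} [AddCommGroup Y] [Module 𝕜 Y] (v : ℕ → Y)
    (a : ℕ →₀ 𝕜) {N : ℕ} (hN : ∀ i ∈ a.support, i < N) :
    Finsupp.linearCombination 𝕜 v a = ∑ i ∈ Finset.range N, a i • v i := by
  rw [Finsupp.linearCombination_apply]
  exact Finsupp.sum_of_support_subset _ (fun i hi => Finset.mem_range.mpr (hN i hi)) _ (by simp)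

theorem lt_sup_support_add_one (a : ℕ →₀ 𝕜) : ∀ i ∈ a.support, i < a.support.sup id + 1 :=
  fun _ hi => Nat.lt_succ_of_le (Finset.le_sup (f := id) hi)

/-- Grünblum's criterion: nonzero vectors with dense span and uniformly bounded partial sum
operators form a Schauder basis. The coordinates are extended from finite combinations by density.
-/
theorem exists_schauderBasis_of_norm_sum_le {Y : Type*} [NormedAddCommGroup Y] [NormedSpace 𝕜 Y]
    (v : ℕ → Y) (hdense : DenseRange (Finsupp.linearCombination 𝕜 v)) (hv : ∀ n, v n ≠ 0) (C : ℝ)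
    (hC : ∀ (a : ℕ →₀ 𝕜) (n : ℕ),
      ‖∑ i ∈ Finset.range n, a i • v i‖ ≤ C * ‖Finsupp.linearCombination 𝕜 v a‖) :
    ∃ b : SchauderBasis 𝕜 Y, ∀ n, b.basis n = v n := by
  set e : (ℕ →₀ 𝕜) →ₗ[𝕜] Y := Finsupp.linearCombination 𝕜 v with he
  have hcoef : ∀ n, ∃ D, ∀ a : ℕ →₀ 𝕜, ‖Finsupp.lapply (R := 𝕜) n a‖ ≤ D * ‖e a‖ := by
    intro n
    refine ⟨2 * C / ‖v n‖, fun a => ?_⟩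
    have hpos : 0 < ‖v n‖ := norm_pos_iff.mpr (hv n)
    have h : a n • v n =
        ∑ i ∈ Finset.range (n + 1), a i • v i - ∑ i ∈ Finset.range n, a i • v i := by
      rw [Finset.sum_range_succ]; abel
    rw [div_mul_eq_mul_div, le_div_iff₀ hpos]
    calc ‖a n‖ * ‖v n‖ = ‖a n • v n‖ := (norm_smul _ _).symm
      _ ≤ C * ‖e a‖ + C * ‖e a‖ := by
        rw [h]; exact (norm_sub_le _ _).trans (add_le_add (hC a _) (hC a _))
      _ = 2 * C * ‖e a‖ := by ring
  let coord : ℕ → StrongDual 𝕜 Y := fun n => (Finsupp.lapply (R := 𝕜) n).extendOfNorm e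
  have hcoord : ∀ n a, coord n (e a) = a n := fun n a =>
    LinearMap.extendOfNorm_eq hdense (hcoef n) a
  have hev : ∀ n, e (Finsupp.single n 1) = v n := fun n => by simp [he]
  have hC0 : 0 ≤ C := by
    by_contra h
    have h1 := hC (Finsupp.single 0 1) 0
    rw [hev] at h1
    have := norm_pos_iff.mpr (hv 0)
    simp at h1
    nlinarith
  have hproj : ∀ n (y : Y), ‖∑ i ∈ Finset.range n, coord i y • v i‖ ≤ C * ‖y‖ := by
    intro n y
    refine hdense.induction_on (p := fun y => ‖∑ i ∈ Finset.range n, coord i y • v i‖ ≤ C * ‖y‖) y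
      (isClosed_le (by fun_prop) (by fun_prop)) fun a => ?_
    simpa only [hcoord] using hC a n
  refine ⟨⟨v, coord, fun i j => ?_, fun y => ?_⟩, fun _ => rfl⟩
  · rw [← hev j, hcoord]
    simp [Finsupp.single_apply, Pi.single_apply, eq_comm]
  · rw [HasSum, SummationFilter.conditional_filter_eq_map_range, tendsto_map'_iff,
      Metric.tendsto_atTop]
    intro ε hε
    obtain ⟨a, ha⟩ := hdense.exists_dist_lt y (ε := ε / (C + 1)) (by positivity)
    refine ⟨a.support.sup id + 1, fun n hn => ?_⟩
    have hsum : ∑ i ∈ Finset.range n, coord i (e a) • v i = e a := by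
      simp only [hcoord]
      exact (linearCombination_eq_sum_range v a fun i hi =>
        (lt_sup_support_add_one a i hi).trans_le hn).symm
    have hsub : ∑ i ∈ Finset.range n, coord i y • v i - y =
        ∑ i ∈ Finset.range n, coord i (y - e a) • v i - (y - e a) := by
      simp only [map_sub, sub_smul, Finset.sum_sub_distrib, hsum]; abel
    rw [Function.comp_apply, dist_eq_norm, hsub]
    rw [dist_eq_norm, lt_div_iff₀ (by positivity)] at ha
    calc _ ≤ C * ‖y - e a‖ + ‖y - e a‖ := (norm_sub_le _ _).trans (by gcongr; exact hproj n _)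
      _ = ‖y - e a‖ * (C + 1) := by ring
      _ < ε := ha

theorem isBasicSequence_of_norm_sum_le (u : ℕ → X) (hu : ∀ n, u n ≠ 0) (C : ℝ)
    (hC : ∀ (a : ℕ →₀ 𝕜) (n : ℕ),
      ‖∑ i ∈ Finset.range n, a i • u i‖ ≤ C * ‖Finsupp.linearCombination 𝕜 u a‖) :
    IsBasicSequence 𝕜 u := by
  set V := (Submodule.span 𝕜 (Set.range u)).topologicalClosure with hV
  have hmem : ∀ n, u n ∈ V := fun n =>
    Submodule.le_topologicalClosure _ (Submodule.subset_span ⟨n, rfl⟩)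
  let v : ℕ → V := fun n => ⟨u n, hmem n⟩
  have hcoe : ∀ a : ℕ →₀ 𝕜, (Finsupp.linearCombination 𝕜 v a : X) =
      Finsupp.linearCombination 𝕜 u a := fun a => by
    simp [Finsupp.linearCombination_apply, Finsupp.sum, v]
  have hdense : DenseRange (Finsupp.linearCombination 𝕜 v) := by
    intro y
    rw [Metric.mem_closure_iff]
    intro ε hε
    have hy : (y : X) ∈ closure (Submodule.span 𝕜 (Set.range u) : Set X) := by
      rw [← Submodule.topologicalClosure_coe]; exact y.2
    obtain ⟨z, hz, hyz⟩ := Metric.mem_closure_iff.mp hy ε hε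
    rw [SetLike.mem_coe, Finsupp.mem_span_range_iff_exists_finsupp] at hz
    obtain ⟨a, rfl⟩ := hz
    refine ⟨_, ⟨a, rfl⟩, ?_⟩
    rwa [Subtype.dist_eq, hcoe, Finsupp.linearCombination_apply]
  obtain ⟨b, hb⟩ := exists_schauderBasis_of_norm_sum_le v hdense
    (fun n h => hu n (congrArg Subtype.val h)) C fun a n => by
      have := hC a n
      rw [← hcoe] at this
      simpa [v] using this
  exact ⟨b, fun n => congrArg Subtype.val (hb n)⟩

/-! ### The reverse lexicographic enumeration -/

theorem rlEnum_zero : rlEnum 0 = (0, 0) := rfl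

theorem rlEnum_succ (n : ℕ) : rlEnum (n + 1) = rlSucc (rlEnum n) :=
  Function.iterate_succ_apply' _ _ _

theorem rlLT_rlEnum_succ (n : ℕ) : rlLT (rlEnum n) (rlEnum (n + 1)) := by
  rw [rlEnum_succ, rlSucc, rlLT]
  split_ifs <;> simp

theorem fst_rlEnum_le (n : ℕ) : (rlEnum n).1 ≤ n := by
  induction n with
  | zero => simp [rlEnum_zero]
  | succ n ih =>
    rw [rlEnum_succ, rlSucc]
    split_ifs
    · exact Nat.succ_le_succ ih
    · exact Nat.zero_le _

theorem rlLT_trans {p q s : ℕ × ℕ} (h₁ : rlLT p q) (h₂ : rlLT q s) : rlLT p s := by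
  unfold rlLT at *; omega

theorem rlLT_irrefl (p : ℕ × ℕ) : ¬ rlLT p p := by
  unfold rlLT; omega

theorem rlLT_rlEnum {m n : ℕ} (h : m < n) : rlLT (rlEnum m) (rlEnum n) := by
  induction n, h using Nat.le_induction with
  | base => exact rlLT_rlEnum_succ m
  | succ n _ ih => exact rlLT_trans ih (rlLT_rlEnum_succ n)

theorem lt_of_rlLT_rlEnum {m n : ℕ} (h : rlLT (rlEnum m) (rlEnum n)) : m < n := by
  rcases lt_trichotomy m n with h' | rfl | h'
  · exact h'
  · exact absurd h (rlLT_irrefl _)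
  · exact absurd (rlLT_trans h (rlLT_rlEnum h')) (rlLT_irrefl _)

theorem rlEnum_injective : Function.Injective rlEnum := by
  intro m n h
  rcases lt_trichotomy m n with h' | h' | h'
  · exact absurd (h ▸ rlLT_rlEnum h') (rlLT_irrefl _)
  · exact h'
  · exact absurd (h ▸ rlLT_rlEnum h') (rlLT_irrefl _)

/-- Every element of `triIndex` is enumerated. -/
theorem rlEnum_surjOn (j i : ℕ) (h : i ≤ j) : ∃ n, rlEnum n = (i, j) := by
  induction j generalizing i with
  | zero => exact ⟨0, by simp [rlEnum_zero]; omega⟩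
  | succ j ihj =>
    induction i with
    | zero =>
      obtain ⟨n, hn⟩ := ihj j le_rfl
      exact ⟨n + 1, by rw [rlEnum_succ, hn, rlSucc]; simp⟩
    | succ i ihi =>
      obtain ⟨n, hn⟩ := ihi (by omega)
      exact ⟨n + 1, by rw [rlEnum_succ, hn, rlSucc]; simp; omega⟩

/-- The position of an element of `triIndex` in the enumeration `rlEnum`; junk off `triIndex`. -/
noncomputable def rlIndex (p : ℕ × ℕ) : ℕ := Function.invFun rlEnum p

theorem rlIndex_rlEnum (n : ℕ) : rlIndex (rlEnum n) = n :=
  Function.leftInverse_invFun rlEnum_injective n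

theorem rlEnum_rlIndex {p : ℕ × ℕ} (hp : p ∈ triIndex) : rlEnum (rlIndex p) = p :=
  Function.invFun_eq (rlEnum_surjOn p.2 p.1 hp)

theorem rlIndex_lt_rlIndex {p q : ℕ × ℕ} (hp : p ∈ triIndex) (hq : q ∈ triIndex)
    (h : rlLT p q) : rlIndex p < rlIndex q := by
  apply lt_of_rlLT_rlEnum
  rwa [rlEnum_rlIndex hp, rlEnum_rlIndex hq]

/-! ### Functionals: finite nets, limit trees, and the selection -/

/-- The unit ball of the dual admits a finite net with respect to the values on `k` vectors of
norm at most `C`. The point is that its size `N` depends only on `k`, `C` and `τ`, not on the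
vectors. -/
theorem exists_net_of_card_eq {ι : Type*} (k : ℕ) (C : ℝ) {τ : ℝ} (hτ : 0 < τ) :
    ∃ N : ℕ, ∀ (s : Finset ι) (v : ι → X), s.card = k → (∀ l ∈ s, ‖v l‖ ≤ C) →
      ∃ φ : ℕ → StrongDual 𝕜 X, (∀ i, ‖φ i‖ ≤ 1) ∧
        ∀ f : StrongDual 𝕜 X, ‖f‖ ≤ 1 → ∃ i < N, ∀ l ∈ s, ‖φ i (v l) - f (v l)‖ ≤ τ := by
  classical
  obtain ⟨t, -, htfin, ht⟩ := (isCompact_closedBall (0 : Fin k → 𝕜) (max C 0)).finite_cover_balls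
    (half_pos hτ)
  obtain ⟨N, d, -, rfl⟩ := htfin.fin_param
  refine ⟨N, fun s v hs hv => ?_⟩
  let e : Fin k ≃ s := (s.equivFinOfCardEq hs).symm
  let good : ℕ → StrongDual 𝕜 X → Prop := fun i f =>
    ‖f‖ ≤ 1 ∧ ∃ h : i < N, ∀ l, ‖f (v (e l)) - d ⟨i, h⟩ l‖ ≤ τ / 2
  let φ : ℕ → StrongDual 𝕜 X := fun i => if h : ∃ f, good i f then h.choose else 0
  refine ⟨φ, fun i => ?_, fun f hf => ?_⟩
  · simp only [φ]
    split_ifs with h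
    · exact h.choose_spec.1
    · simp
  · have hmem : (fun l => f (v (e l))) ∈ Metric.closedBall (0 : Fin k → 𝕜) (max C 0) := by
      rw [mem_closedBall_zero_iff, pi_norm_le_iff_of_nonneg (le_max_right _ _)]
      exact fun l => ((f.le_of_opNorm_le hf _).trans (by simpa using hv _ (e l).2)).trans
        (le_max_left _ _)
    have := ht hmem
    simp only [Set.mem_iUnion, Set.mem_range, exists_prop, exists_exists_eq_and] at this
    obtain ⟨i, hi⟩ := this
    rw [Metric.mem_ball, dist_eq_norm] at hi
    have hgood : ∃ f, good i f := ⟨f, hf, i.2, fun l => (norm_le_pi_norm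
      ((fun l => f (v (e l))) - d i) l).trans hi.le⟩
    refine ⟨i, i.2, fun l hl => ?_⟩
    have hφ : φ i = hgood.choose := dif_pos hgood
    obtain ⟨_, _, h1⟩ := hgood.choose_spec
    rw [← hφ] at h1
    obtain ⟨l', hl'⟩ := e.surjective ⟨l, hl⟩
    have h1 := h1 l'
    have h2 := (norm_le_pi_norm ((fun l => f (v (e l))) - d i) l').trans hi.le
    simp only [Pi.sub_apply, hl'] at h1 h2
    calc ‖φ i (v l) - f (v l)‖ = ‖(φ i (v l) - d i l') - (f (v l) - d i l')‖ := by
          congr 1; abel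
      _ ≤ τ / 2 + τ / 2 := (norm_sub_le _ _).trans (add_le_add h1 h2)
      _ = τ := by ring

theorem exists_finset_net (n : ℕ) (u : ℕ → X) (δ : ℕ → ℝ) (hδ : ∀ i, 0 < δ i) :
    ∃ T : Finset (StrongDual 𝕜 X), (∀ ψ ∈ T, ‖ψ‖ ≤ 1) ∧
      ∀ f : StrongDual 𝕜 X, ‖f‖ ≤ 1 → ∃ ψ ∈ T, ∀ i < n, ‖ψ (u i) - f (u i)‖ ≤ δ i := by
  classical
  obtain ⟨τ, hτ, hτδ⟩ : ∃ τ > 0, ∀ i < n, τ ≤ δ i := by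
    rcases Nat.eq_zero_or_pos n with rfl | hn
    · exact ⟨1, one_pos, by simp⟩
    · obtain ⟨i, -, hi⟩ := Finset.exists_min_image (Finset.range n) δ ⟨0, by simpa using hn⟩
      exact ⟨δ i, hδ i, fun j hj => hi j (by simpa using hj)⟩
  obtain ⟨N, hN⟩ := exists_net_of_card_eq (𝕜 := 𝕜) (X := X) (ι := ℕ) n
    (∑ i ∈ Finset.range n, ‖u i‖) hτ
  obtain ⟨φ, hφ, hnet⟩ := hN (Finset.range n) u (by simp) fun l hl =>
    Finset.single_le_sum (f := fun i => ‖u i‖) (fun _ _ => norm_nonneg _) hl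
  refine ⟨(Finset.range N).image φ, by simpa using fun i _ => hφ i, fun f hf => ?_⟩
  obtain ⟨i, hi, h⟩ := hnet f hf
  exact ⟨φ i, Finset.mem_image_of_mem _ (by simpa using hi),
    fun j hj => (h j (by simpa using hj)).trans (hτδ j hj)⟩

theorem exists_weakStar_limit {ι : Type*} (U : Ultrafilter ι) (F : ι → StrongDual 𝕜 X)
    (hF : ∀ l, ‖F l‖ ≤ 1) :
    ∃ f : StrongDual 𝕜 X, ‖f‖ ≤ 1 ∧ ∀ v, Tendsto (fun l => F l v) U (𝓝 (f v)) := by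
  have hc := WeakDual.isCompact_closedBall (𝕜 := 𝕜) (E := X) 0 1
  obtain ⟨f, hf, hlim⟩ := hc.ultrafilter_le_nhds' (U.map fun l => StrongDual.toWeakDual (F l))
    (by
      refine Ultrafilter.mem_map.mpr (Filter.univ_mem' fun l => ?_)
      simpa using hF l)
  refine ⟨WeakDual.toStrongDual f, by simpa using hf, fun v => ?_⟩
  exact ((WeakDual.eval_continuous v).tendsto f).comp
    (show Tendsto (fun l => StrongDual.toWeakDual (F l)) U (𝓝 f) from hlim)

/-- Starting from a functional `L S` for every `k`-element set `S` of indices, take iterated weak*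
limits along `U` in the largest element: this attaches to each smaller set `S` a functional `Φ S`
which is the weak* limit of `Φ (insert l S)` as `l` tends to infinity along `U`. -/
theorem exists_limit_tree (U : Ultrafilter ℕ) (hU : (U : Filter ℕ) ≤ atTop)
    (L : Finset ℕ → StrongDual 𝕜 X) (hL : ∀ S, ‖L S‖ ≤ 1) (k : ℕ) :
    ∃ Φ : Finset ℕ → StrongDual 𝕜 X, (∀ S, ‖Φ S‖ ≤ 1) ∧ (∀ S, S.card = k → Φ S = L S) ∧
      ∀ S, S.card < k → ∀ v, Tendsto (fun l => Φ (insert l S) v) U (𝓝 (Φ S v)) := by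
  have hstep : ∀ Φ : {Φ : Finset ℕ → StrongDual 𝕜 X // ∀ S, ‖Φ S‖ ≤ 1},
      ∃ Φ' : {Φ : Finset ℕ → StrongDual 𝕜 X // ∀ S, ‖Φ S‖ ≤ 1},
      ∀ S v, Tendsto (fun l => Φ.1 (insert l S) v) U (𝓝 (Φ'.1 S v)) := by
    intro Φ
    choose Φ' hΦ' hlim using fun S : Finset ℕ =>
      exists_weakStar_limit U (fun l => Φ.1 (insert l S)) fun l => Φ.2 _
    exact ⟨⟨Φ', hΦ'⟩, hlim⟩
  choose lim hlim using hstep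
  let Φ : ℕ → {Φ : Finset ℕ → StrongDual 𝕜 X // ∀ S, ‖Φ S‖ ≤ 1} := fun d => lim^[d] ⟨L, hL⟩
  refine ⟨fun S => (Φ (k - S.card)).1 S, fun S => (Φ _).2 S, fun S hS => by simp [hS, Φ],
    fun S hS v => ?_⟩
  have hd : k - S.card = (k - (S.card + 1)) + 1 := by omega
  have hΦ : Φ (k - S.card) = lim (Φ (k - (S.card + 1))) := by
    rw [hd]; exact Function.iterate_succ_apply' _ _ _
  simp only [hΦ]
  refine (hlim (Φ (k - (S.card + 1))) S v).congr' ?_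
  -- A new index `l` lies beyond `S`, so that `insert l S` has one element more than `S`.
  filter_upwards [hU (eventually_gt_atTop (S.sup id))] with l hl
  have hlS : l ∉ S := fun h => absurd (Finset.le_sup (f := id) h) (not_le.mpr hl)
  rw [Finset.card_insert_of_notMem hlS]

/-- Recursive choice: the predicate `P n s` on the value at `n` may refer to the history, which is
carried by any `s` that agrees with the sequence below `n`. -/
theorem exists_seq_of_forall_exists (P : ℕ → (ℕ → ℕ) → ℕ → Prop) (h : ∀ n s, ∃ l, P n s l) :
    ∃ m : ℕ → ℕ, ∀ n, ∃ s : ℕ → ℕ, (∀ i < n, s i = m i) ∧ P n s (m n) := by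
  choose g hg using h
  -- `hist n` is the sequence below `n`, continued by zeros.
  let hist : ℕ → ℕ → ℕ := fun n => Nat.rec (fun _ => 0) (fun n s => Function.update s n (g n s)) n
  have hs : ∀ n, hist (n + 1) = Function.update (hist n) n (g n (hist n)) := fun n => rfl
  refine ⟨fun n => g n (hist n), fun n => ⟨hist n, ?_, hg n _⟩⟩
  induction n with
  | zero => simp
  | succ n ih =>
    intro i hi
    rw [hs]
    rcases Nat.lt_succ_iff_lt_or_eq.mp hi with hi | rfl
    · rw [Function.update_of_ne hi.ne]; exact ih i hi
    · simp

/-- The diagonal choice of indices. At stage `n`, the new index `m n` is taken so large that the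
functionals attached to sets of earlier indices are small at the new vector (weak nullity), and
that inserting `m n` into such a set hardly changes its functional at the earlier vectors (the
limit along `U`). The functionals in `Ψ t` are determined by the first `t` indices and must be
small at all later vectors. -/
theorem exists_selection (U : Ultrafilter ℕ) (hU : (U : Filter ℕ) ≤ atTop) (z : ℕ → ℕ → X)
    (hz : ∀ n (f : StrongDual 𝕜 X), Tendsto (fun l => f (z n l)) atTop (𝓝 0))
    {α : Type*} (A : ℕ → Finset α) (Φ : α → Finset ℕ → StrongDual 𝕜 X) (k : α → ℕ)
    (hΦ : ∀ a S, S.card < k a → ∀ v, Tendsto (fun l => Φ a (insert l S) v) U (𝓝 (Φ a S v)))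
    (Ψ : (n : ℕ) → (Fin n → ℕ) → Finset (StrongDual 𝕜 X)) (δ : ℕ → ℝ) (hδ : ∀ n, 0 < δ n) :
    ∃ m : ℕ → ℕ, StrictMono m ∧
      (∀ n, ∀ a ∈ A n, ∀ S ⊆ (Finset.range n).image m, ‖Φ a S (z n (m n))‖ ≤ δ n) ∧
      (∀ n, ∀ a ∈ A n, ∀ S ⊆ (Finset.range n).image m, S.card < k a → ∀ t < n,
        ‖Φ a (insert (m n) S) (z t (m t)) - Φ a S (z t (m t))‖ ≤ δ t * (1 / 2) ^ n) ∧
      ∀ n, ∀ t ≤ n, ∀ ψ ∈ Ψ t (fun i => m i), ‖ψ (z n (m n))‖ ≤ δ n := by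
  have hsmall : ∀ n (f : StrongDual 𝕜 X), ∀ᶠ l in (U : Filter ℕ), ‖f (z n l)‖ ≤ δ n := by
    intro n f
    have := ((hz n f).mono_left hU).norm
    rw [norm_zero] at this
    exact this.eventually_le_const (hδ n)
  let P : ℕ → (ℕ → ℕ) → ℕ → Prop := fun n s l =>
    (∀ t ∈ Finset.range n, s t < l) ∧
    (∀ a ∈ A n, ∀ S ∈ ((Finset.range n).image s).powerset, ‖Φ a S (z n l)‖ ≤ δ n) ∧
    (∀ a ∈ A n, ∀ S ∈ ((Finset.range n).image s).powerset, ∀ t ∈ Finset.range n, S.card < k a →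
      ‖Φ a (insert l S) (z t (s t)) - Φ a S (z t (s t))‖ ≤ δ t * (1 / 2) ^ n) ∧
    ∀ t ∈ Finset.range (n + 1), ∀ ψ ∈ Ψ t (fun i => s i), ‖ψ (z n l)‖ ≤ δ n
  obtain ⟨m, hm⟩ := exists_seq_of_forall_exists P fun n s => by
    refine Eventually.exists (f := (U : Filter ℕ)) (((eventually_all_finset _).mpr fun t _ =>
      hU (eventually_gt_atTop _)).and (((eventually_all_finset _).mpr fun a _ =>
      (eventually_all_finset _).mpr fun S _ => hsmall _ _).and
      (((eventually_all_finset _).mpr fun a _ => (eventually_all_finset _).mpr fun S _ =>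
      (eventually_all_finset _).mpr fun t _ => ?_).and
      ((eventually_all_finset _).mpr fun t _ => (eventually_all_finset _).mpr fun ψ _ =>
      hsmall _ _))))
    by_cases hS : S.card < k a
    · have h := ((hΦ a S hS (z t (s t))).sub_const (Φ a S (z t (s t)))).norm
      rw [sub_self, norm_zero] at h
      filter_upwards [h.eventually_le_const
        (mul_pos (hδ t) (by positivity : (0 : ℝ) < (1 / 2) ^ n))]
        with l hl _ using hl
    · exact Eventually.of_forall fun l h => absurd h hS
  refine ⟨m, ?_, ?_, ?_, ?_⟩
  · refine strictMono_nat_of_lt_succ fun n => ?_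
    obtain ⟨s, hs, h, -⟩ := hm (n + 1)
    simpa [hs] using h n (by simp)
  · intro n a ha S hS
    obtain ⟨s, hs, -, h, -⟩ := hm n
    refine h a ha S (Finset.mem_powerset.mpr ?_)
    rwa [Finset.image_congr fun i hi => hs i (by simpa using hi)]
  · intro n a ha S hS hc t ht
    obtain ⟨s, hs, -, -, h, -⟩ := hm n
    rw [← hs t ht]
    refine h a ha S (Finset.mem_powerset.mpr ?_) t (by simpa using ht) hc
    rwa [Finset.image_congr fun i hi => hs i (by simpa using hi)]
  · intro n t ht ψ hψ
    obtain ⟨s, hs, -, -, -, h⟩ := hm n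
    refine h t (by simpa [Nat.lt_succ_iff] using ht) ψ ?_
    rwa [show (fun i : Fin t => s i) = fun i : Fin t => m i from
      funext fun i => hs i (i.2.trans_le ht)]

/-- Off the set `P`, the functional attached to `P` is small: at `n`, the part of `P` below `n`
gives a functional that is small there, and inserting the elements of `P` beyond `n` one by one
changes its value by a geometric series. -/
theorem norm_limit_tree_le {k : ℕ} {Φ : Finset ℕ → StrongDual 𝕜 X} {m : ℕ → ℕ} (hm : StrictMono m)
    {y : ℕ → X} {δ : ℕ → ℝ} (hδ : ∀ n, 0 < δ n) {q : ℕ}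
    (hsmall : ∀ n ≥ q, ∀ S ⊆ (Finset.range n).image m, ‖Φ S (y n)‖ ≤ δ n)
    (hclose : ∀ n ≥ q, ∀ S ⊆ (Finset.range n).image m, S.card < k → ∀ t < n,
      ‖Φ (insert (m n) S) (y t) - Φ S (y t)‖ ≤ δ t * (1 / 2) ^ n)
    {P : Finset ℕ} (hP : P.card ≤ k) {n : ℕ} (hn : q ≤ n) (hnP : n ∉ P) :
    ‖Φ (P.image m) (y n)‖ ≤ 3 * δ n := by
  have key : ∀ P₀ P₁ : Finset ℕ, (∀ p ∈ P₀, p < n) → (∀ p ∈ P₁, n < p) → (P₀ ∪ P₁).card ≤ k →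
      ‖Φ ((P₀ ∪ P₁).image m) (y n) - Φ (P₀.image m) (y n)‖ ≤ ∑ p ∈ P₁, δ n * (1 / 2) ^ p := by
    intro P₀ P₁ h₀
    induction P₁ using Finset.induction_on_max with
    | empty => simp
    | insert p P₁ hp ih =>
      intro h₁ hc
      have hnp : n < p := h₁ p (Finset.mem_insert_self _ _)
      have hp₁ : p ∉ P₁ := fun h => lt_irrefl _ (hp p h)
      have hlt : ∀ x ∈ P₀ ∪ P₁, x < p := fun x hx => by
        rcases Finset.mem_union.mp hx with h | h
        · exact (h₀ x h).trans hnp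
        · exact hp x h
      have hpu : p ∉ P₀ ∪ P₁ := fun h => lt_irrefl _ (hlt p h)
      rw [Finset.union_insert, Finset.card_insert_of_notMem hpu] at hc
      have h1 := ih (fun x hx => h₁ x (Finset.mem_insert_of_mem hx)) (by omega)
      have h2 := hclose p (hn.trans hnp.le) ((P₀ ∪ P₁).image m)
        (Finset.image_subset_image fun x hx => by simpa using hlt x hx)
        (by rw [Finset.card_image_of_injective _ hm.injective]; omega) n hnp
      rw [Finset.union_insert, Finset.image_insert, Finset.sum_insert hp₁]
      exact (norm_sub_le_norm_sub_add_norm_sub _ _ _).trans (add_le_add h2 h1)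
  have hsplit : P.filter (· < n) ∪ P.filter (n < ·) = P := by
    ext p
    simp only [Finset.mem_union, Finset.mem_filter]
    refine ⟨by tauto, fun h => ?_⟩
    rcases lt_trichotomy p n with h' | rfl | h'
    · tauto
    · exact absurd h hnP
    · tauto
  have h1 := key (P.filter (· < n)) (P.filter (n < ·)) (by simp) (by simp) (by rwa [hsplit])
  rw [hsplit, ← Finset.mul_sum] at h1
  have h2 := hsmall n hn ((P.filter (· < n)).image m)
    (Finset.image_subset_image fun x hx => by simpa using (Finset.mem_filter.mp hx).2)
  have h3 : ∑ p ∈ P.filter (n < ·), (1 / 2 : ℝ) ^ p ≤ 2 :=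
    (summable_geometric_two.sum_le_tsum _ fun _ _ => by positivity).trans tsum_geometric_two.le
  have h4 : δ n * ∑ p ∈ P.filter (n < ·), (1 / 2 : ℝ) ^ p ≤ δ n * 2 :=
    mul_le_mul_of_nonneg_left h3 (hδ n).le
  calc _ = ‖(Φ (P.image m) (y n) - Φ ((P.filter (· < n)).image m) (y n)) +
        Φ ((P.filter (· < n)).image m) (y n)‖ := by rw [sub_add_cancel]
    _ ≤ _ := norm_add_le _ _
    _ ≤ 3 * δ n := by linarith

/-! ### Norm estimates -/

/-- If every functional in the dual unit ball can be replaced by one, also in the ball, that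
almost agrees with it on the vectors with index in `P` and almost vanishes on the others, then
restricting a sum to `P` almost does not increase its norm. -/
theorem norm_sum_le_of_functionals {P s : Finset ℕ} (hPs : P ⊆ s) (y : ℕ → X) (d : ℕ → ℝ)
    (h : ∀ f : StrongDual 𝕜 X, ‖f‖ ≤ 1 → ∃ g : StrongDual 𝕜 X, ‖g‖ ≤ 1 ∧
      (∀ i ∈ P, ‖g (y i) - f (y i)‖ ≤ d i) ∧ ∀ i ∈ s, i ∉ P → ‖g (y i)‖ ≤ d i) (a : ℕ → 𝕜) :
    ‖∑ i ∈ P, a i • y i‖ ≤ ‖∑ i ∈ s, a i • y i‖ + ∑ i ∈ s, d i * ‖a i‖ := by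
  classical
  obtain ⟨f, hf, hfP⟩ := exists_dual_vector'' 𝕜 (∑ i ∈ P, a i • y i)
  obtain ⟨g, hg, hgP, hgs⟩ := h f hf
  -- The error of `g` as an approximate truncation of `f` to `P`.
  let e : ℕ → 𝕜 := fun i => g (y i) - if i ∈ P then f (y i) else 0
  have he : ∀ i ∈ s, ‖a i * e i‖ ≤ d i * ‖a i‖ := by
    intro i hi
    rw [norm_mul, mul_comm]
    refine mul_le_mul_of_nonneg_right ?_ (norm_nonneg _)
    simp only [e]
    split_ifs with hP
    · exact hgP i hP
    · simpa using hgs i hi hP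
  have hsum : f (∑ i ∈ P, a i • y i) = g (∑ i ∈ s, a i • y i) - ∑ i ∈ s, a i * e i := by
    simp only [map_sum, map_smul, smul_eq_mul, e, mul_sub, Finset.sum_sub_distrib, sub_sub_cancel,
      mul_ite, mul_zero]
    rw [Finset.sum_ite_mem, Finset.inter_eq_right.mpr hPs]
  calc ‖∑ i ∈ P, a i • y i‖ = ‖f (∑ i ∈ P, a i • y i)‖ := by
        rw [hfP, RCLike.norm_ofReal, abs_of_nonneg (norm_nonneg _)]
    _ ≤ ‖g (∑ i ∈ s, a i • y i)‖ + ‖∑ i ∈ s, a i * e i‖ := by rw [hsum]; exact norm_sub_le _ _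
    _ ≤ _ := add_le_add ((g.le_of_opNorm_le hg _).trans (by simp))
        ((norm_sum_le _ _).trans (Finset.sum_le_sum he))

theorem sum_geometric_weight_le (s : Finset ℕ) {η A : ℝ} (hη : 0 ≤ η) (hA : 0 ≤ A) {c b : ℕ → ℝ}
    (h : ∀ i ∈ s, c i * b i ≤ A) : ∑ i ∈ s, η * (1 / 2) ^ i * c i * b i ≤ 2 * η * A := by
  calc ∑ i ∈ s, η * (1 / 2) ^ i * c i * b i ≤ ∑ i ∈ s, η * A * (1 / 2) ^ i :=
        Finset.sum_le_sum fun i hi => by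
          have := mul_le_mul_of_nonneg_left (h i hi) (by positivity : 0 ≤ η * (1 / 2 : ℝ) ^ i)
          linarith
    _ = η * A * ∑ i ∈ s, (1 / 2 : ℝ) ^ i := by rw [Finset.mul_sum]
    _ ≤ η * A * 2 := mul_le_mul_of_nonneg_left
        ((summable_geometric_two.sum_le_tsum _ fun _ _ => by positivity).trans
          tsum_geometric_two.le)
        (by positivity)
    _ = 2 * η * A := by ring

/-- If every functional in the dual unit ball can be approximately truncated to each initial
segment, then the partial sum operators are almost contractive and the coefficients are bounded.
-/
theorem norm_partial_sum_and_coeff_le {y : ℕ → X} {c : ℕ → ℝ} (hc : ∀ n, 0 < c n)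
    (hcy : ∀ n, c n ≤ ‖y n‖) {η : ℝ} (hη : 0 < η) (hη' : η ≤ 1 / 8)
    (hinit : ∀ t, ∀ f : StrongDual 𝕜 X, ‖f‖ ≤ 1 → ∃ g : StrongDual 𝕜 X, ‖g‖ ≤ 1 ∧
      (∀ i < t, ‖g (y i) - f (y i)‖ ≤ η * (1 / 2) ^ i * c i) ∧
      ∀ i ≥ t, ‖g (y i)‖ ≤ η * (1 / 2) ^ i * c i) (a : ℕ → 𝕜) (N : ℕ) :
    (∀ t ≤ N, ‖∑ i ∈ Finset.range t, a i • y i‖ ≤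
      (1 + 8 * η) * ‖∑ i ∈ Finset.range N, a i • y i‖) ∧
    ∀ n < N, c n * ‖a n‖ ≤ 4 * ‖∑ i ∈ Finset.range N, a i • y i‖ := by
  set z := ∑ i ∈ Finset.range N, a i • y i with hz
  rcases Nat.eq_zero_or_pos N with rfl | hN
  · simp +contextual [hz]
  obtain ⟨n₀, hn₀, hmax⟩ := Finset.exists_max_image (Finset.range N) (fun n => c n * ‖a n‖)
    ⟨0, by simpa using hN⟩
  set A := c n₀ * ‖a n₀‖ with hA
  have hA0 : 0 ≤ A := mul_nonneg (hc _).le (norm_nonneg _)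
  have hpart : ∀ t ≤ N, ‖∑ i ∈ Finset.range t, a i • y i‖ ≤ ‖z‖ + 2 * η * A := by
    intro t ht
    refine (norm_sum_le_of_functionals (𝕜 := 𝕜) (Finset.range_subset_range.mpr ht) y
      (fun i => η * (1 / 2) ^ i * c i) (fun f hf => ?_) a).trans
      (add_le_add_right (sum_geometric_weight_le _ hη.le hA0 hmax) _)
    obtain ⟨g, hg, h₁, h₂⟩ := hinit t f hf
    exact ⟨g, hg, fun i hi => h₁ i (by simpa using hi), fun i _ hi => h₂ i (by simpa using hi)⟩
  -- The largest coefficient is itself controlled by two partial sums, which absorbs the error term.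
  have hAz : A ≤ 4 * ‖z‖ := by
    have hn₀N : n₀ < N := by simpa using hn₀
    have h1 := hpart n₀ hn₀N.le
    have h2 := hpart (n₀ + 1) hn₀N
    have h3 : a n₀ • y n₀ =
        ∑ i ∈ Finset.range (n₀ + 1), a i • y i - ∑ i ∈ Finset.range n₀, a i • y i := by
      rw [Finset.sum_range_succ]; abel
    have h4 : A ≤ ‖a n₀ • y n₀‖ := by
      rw [norm_smul, hA, mul_comm]
      exact mul_le_mul_of_nonneg_left (hcy _) (norm_nonneg _)
    have h5 : ‖a n₀ • y n₀‖ ≤ _ := h3 ▸ norm_sub_le _ _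
    have h6 : η * A ≤ 1 / 8 * A := mul_le_mul_of_nonneg_right hη' hA0
    linarith
  refine ⟨fun t ht => (hpart t ht).trans ?_, fun n hn => (hmax n (by simpa using hn)).trans hAz⟩
  have := mul_le_mul_of_nonneg_left hAz hη.le
  linarith

/-- The constant `2`: cutting off the part before `q` costs a factor of almost `2`, and the
passage from the remaining sum to its part in `P` costs almost nothing. -/
theorem norm_sum_subset_le {y : ℕ → X} {c : ℕ → ℝ} (hc : ∀ n, 0 < c n)
    (hcy : ∀ n, c n ≤ ‖y n‖) {η : ℝ} (hη : 0 < η) (hη' : η ≤ 1 / 8)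
    (hinit : ∀ t, ∀ f : StrongDual 𝕜 X, ‖f‖ ≤ 1 → ∃ g : StrongDual 𝕜 X, ‖g‖ ≤ 1 ∧
      (∀ i < t, ‖g (y i) - f (y i)‖ ≤ η * (1 / 2) ^ i * c i) ∧
      ∀ i ≥ t, ‖g (y i)‖ ≤ η * (1 / 2) ^ i * c i)
    {P : Finset ℕ} {q : ℕ}
    (hP : ∀ f : StrongDual 𝕜 X, ‖f‖ ≤ 1 → ∃ g : StrongDual 𝕜 X, ‖g‖ ≤ 1 ∧
      (∀ i ∈ P, ‖g (y i) - f (y i)‖ ≤ η * c i / (P.card + 1)) ∧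
      ∀ i ≥ q, i ∉ P → ‖g (y i)‖ ≤ 3 * (η * (1 / 2) ^ i * c i))
    {N : ℕ} (hqN : q ≤ N) (hPN : P ⊆ Finset.Ico q N) (a : ℕ → 𝕜) :
    ‖∑ i ∈ P, a i • y i‖ ≤ (2 + 36 * η) * ‖∑ i ∈ Finset.range N, a i • y i‖ := by
  classical
  obtain ⟨hpart, hcoef⟩ := norm_partial_sum_and_coeff_le hc hcy hη hη' hinit a N
  set z := ∑ i ∈ Finset.range N, a i • y i with hz
  have htail : ‖∑ i ∈ Finset.Ico q N, a i • y i‖ ≤ (2 + 8 * η) * ‖z‖ := by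
    rw [Finset.sum_Ico_eq_sub _ hqN]
    refine (norm_sub_le _ _).trans ?_
    have := hpart q hqN
    linarith
  let d : ℕ → ℝ := fun i =>
    (if i ∈ P then η * c i / (P.card + 1) else 0) + 3 * (η * (1 / 2) ^ i * c i)
  have hd : ∀ i, 0 ≤ η * (1 / 2) ^ i * c i := fun i => by have := (hc i).le; positivity
  have h1 := norm_sum_le_of_functionals (𝕜 := 𝕜) hPN y d (fun f hf => by
    obtain ⟨g, hg, h₁, h₂⟩ := hP f hf
    refine ⟨g, hg, fun i hi => ?_, fun i hi hiP => ?_⟩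
    · simp only [d, if_pos hi]
      have := h₁ i hi
      have := hd i
      linarith
    · simpa only [d, if_neg hiP, zero_add] using h₂ i (Finset.mem_Ico.mp hi).1 hiP) a
  have hcoef' : ∀ i ∈ Finset.Ico q N, c i * ‖a i‖ ≤ 4 * ‖z‖ := fun i hi =>
    hcoef i (Finset.mem_Ico.mp hi).2
  have h2 : ∑ i ∈ Finset.Ico q N, 3 * (η * (1 / 2) ^ i * c i) * ‖a i‖ ≤
      3 * (2 * η * (4 * ‖z‖)) := by
    refine le_trans (le_of_eq ?_) (mul_le_mul_of_nonneg_left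
      (sum_geometric_weight_le _ hη.le (by positivity) hcoef') (by norm_num : (0 : ℝ) ≤ 3))
    rw [Finset.mul_sum]
    exact Finset.sum_congr rfl fun i _ => by ring
  have h3 : ∑ i ∈ Finset.Ico q N, (if i ∈ P then η * c i / (P.card + 1) else 0) * ‖a i‖ ≤
      η * (4 * ‖z‖) := by
    simp only [ite_mul, zero_mul]
    rw [Finset.sum_ite_mem, Finset.inter_eq_right.mpr hPN]
    calc ∑ i ∈ P, η * c i / (P.card + 1) * ‖a i‖
        ≤ ∑ i ∈ P, η * (4 * ‖z‖) / (P.card + 1) := Finset.sum_le_sum fun i hi => by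
          rw [div_mul_eq_mul_div, mul_assoc]
          have := hcoef' i (hPN hi)
          gcongr
      _ = P.card / (P.card + 1) * (η * (4 * ‖z‖)) := by
          rw [Finset.sum_const, nsmul_eq_mul]; ring
      _ ≤ 1 * (η * (4 * ‖z‖)) := mul_le_mul_of_nonneg_right
          (div_le_one_of_le₀ (by linarith) (by positivity)) (by positivity)
      _ = _ := one_mul _
  have h4 : ∑ i ∈ Finset.Ico q N, d i * ‖a i‖ ≤ η * (4 * ‖z‖) + 3 * (2 * η * (4 * ‖z‖)) := by
    simp only [d, add_mul, Finset.sum_add_distrib]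
    exact add_le_add h3 h2
  linarith

/-! ### Schreier-type selection in an array -/

/-- Indices `m` such that the vectors `w (r i) (m i)` admit approximate truncations of the
functionals in the dual unit ball both to every initial segment and, beyond the position `q`, to
every set `P` of at most `K q` positions in the row of `q`. -/
theorem exists_schreier_selection (w : ℕ → ℕ → X)
    (hw : ∀ i (f : StrongDual 𝕜 X), Tendsto (fun l => f (w i l)) atTop (𝓝 0))
    (C : ℕ → ℝ) (hC : ∀ i l, ‖w i l‖ ≤ C i) (r : ℕ → ℕ) (K : ℕ → ℕ)
    (c : ℕ → ℝ) (hc : ∀ i, 0 < c i) {η : ℝ} (hη : 0 < η) :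
    ∃ m : ℕ → ℕ, StrictMono m ∧
      (∀ t, ∀ f : StrongDual 𝕜 X, ‖f‖ ≤ 1 → ∃ g : StrongDual 𝕜 X, ‖g‖ ≤ 1 ∧
        (∀ i < t, ‖g (w (r i) (m i)) - f (w (r i) (m i))‖ ≤ η * (1 / 2) ^ i * c (r i)) ∧
        ∀ i ≥ t, ‖g (w (r i) (m i))‖ ≤ η * (1 / 2) ^ i * c (r i)) ∧
      ∀ (q : ℕ) (P : Finset ℕ), (∀ p ∈ P, r p = r q) → P.card ≤ K q →
        ∀ f : StrongDual 𝕜 X, ‖f‖ ≤ 1 → ∃ g : StrongDual 𝕜 X, ‖g‖ ≤ 1 ∧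
          (∀ i ∈ P, ‖g (w (r i) (m i)) - f (w (r i) (m i))‖ ≤ η * c (r i) / (P.card + 1)) ∧
          ∀ i ≥ q, i ∉ P → ‖g (w (r i) (m i))‖ ≤ 3 * (η * (1 / 2) ^ i * c (r i)) := by
  classical
  set U : Ultrafilter ℕ := hyperfilter ℕ
  have hU : (U : Filter ℕ) ≤ atTop := Nat.hyperfilter_le_atTop
  have hδ : ∀ n, 0 < η * (1 / 2) ^ n * c (r n) := fun n => by
    have := hc (r n); positivity
  choose N hN using fun q k : ℕ => exists_net_of_card_eq (𝕜 := 𝕜) (X := X) (ι := ℕ) k (C (r q))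
    (div_pos (mul_pos hη (hc (r q))) (by positivity : (0 : ℝ) < k + 1))
  have hnet : ∀ (q k : ℕ) (S : Finset ℕ), ∃ φ : ℕ → StrongDual 𝕜 X, (∀ i, ‖φ i‖ ≤ 1) ∧
      (S.card = k → ∀ f : StrongDual 𝕜 X, ‖f‖ ≤ 1 → ∃ i < N q k, ∀ l ∈ S,
        ‖φ i (w (r q) l) - f (w (r q) l)‖ ≤ η * c (r q) / (k + 1)) := by
    intro q k S
    by_cases hS : S.card = k
    · obtain ⟨φ, h₁, h₂⟩ := hN q k S (w (r q)) hS fun l _ => hC _ l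
      exact ⟨φ, h₁, fun _ => h₂⟩
    · exact ⟨0, by simp, fun h => absurd h hS⟩
  choose φ hφ hφnet using hnet
  choose Φ hΦ hleaf hlim using fun a : ℕ × ℕ × ℕ => exists_limit_tree U hU
    (fun S => φ a.1 a.2.1 S a.2.2) (fun S => hφ _ _ _ _) a.2.1
  -- The trees with root at most `n`; only finitely many of them matter at a time.
  let A : ℕ → Finset (ℕ × ℕ × ℕ) := fun n => (Finset.range (n + 1)).biUnion fun q =>
    (Finset.range (K q + 1)).biUnion fun k => (Finset.range (N q k)).image fun i => (q, k, i)
  have hA : ∀ {n q k i}, q ≤ n → k ≤ K q → i < N q k → (q, k, i) ∈ A n := by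
    intro n q k i hq hk hi
    simp only [A, Finset.mem_biUnion, Finset.mem_image, Finset.mem_range]
    exact ⟨q, by omega, k, by omega, i, hi, rfl⟩
  choose Ψ hΨ hΨnet using fun (t : ℕ) (s : Fin t → ℕ) => exists_finset_net (𝕜 := 𝕜) t
    (fun i => w (r i) (if h : i < t then s ⟨i, h⟩ else 0)) _ hδ
  obtain ⟨m, hm, hsmall, hclose, hinit⟩ := exists_selection U hU (fun n l => w (r n) l)
    (fun n f => hw _ f) A Φ (fun a => a.2.1) hlim Ψ _ hδ
  refine ⟨m, hm, fun t f hf => ?_, fun q P hP hK f hf => ?_⟩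
  · obtain ⟨g, hg, h⟩ := hΨnet t (fun i => m i) f hf
    exact ⟨g, hΨ _ _ g hg, fun i hi => by simpa [hi] using h i hi, fun i hi => hinit i t hi g hg⟩
  · have hcard : (P.image m).card = P.card := Finset.card_image_of_injective _ hm.injective
    obtain ⟨i, hi, h⟩ := hφnet q P.card (P.image m) hcard f hf
    refine ⟨Φ (q, P.card, i) (P.image m), hΦ _ _, fun p hp => ?_, fun n hn hnP => ?_⟩
    · rw [hleaf (q, P.card, i) _ hcard, hP p hp]
      exact h _ (Finset.mem_image_of_mem m hp)
    · exact norm_limit_tree_le (y := fun n => w (r n) (m n)) hm hδ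
        (fun n hn S hS => hsmall n _ (hA hn hK hi) S hS)
        (fun n hn S hS => hclose n _ (hA hn hK hi) S hS) le_rfl hn hnP

/-- Distributing a strictly increasing sequence of columns along the enumeration of `triIndex`,
while keeping the rows, produces a subarray. -/
theorem isSubarray_of_strictMono {x : ℕ × ℕ → X} (hx : IsTriArray 𝕜 x) {m : ℕ → ℕ}
    (hm : StrictMono m) : IsSubarray 𝕜 x fun p => x (p.1, m (rlIndex p)) := by
  have hle : ∀ p ∈ triIndex, p.1 ≤ m (rlIndex p) := fun p hp => by
    have := fst_rlEnum_le (rlIndex p)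
    rw [rlEnum_rlIndex hp] at this
    exact this.trans (hm.id_le _)
  have hmem : ∀ i k, (i, i + k) ∈ triIndex := fun i k => Nat.le_add_right i k
  refine ⟨fun i => ?_, fun i => ?_, fun p => (p.1, m (rlIndex p)), hle,
    fun p hp q hq h => Or.inl ?_, fun p hp => rfl⟩
  · obtain ⟨⟨c, C, hc, h⟩, hnull⟩ := hx i
    let k' : ℕ → ℕ := fun k => m (rlIndex (i, i + k)) - i
    have hk' : ∀ k, x (i, m (rlIndex (i, i + k))) = x (i, i + k' k) := fun k => by
      simp only [k', Nat.add_sub_cancel' (hle _ (hmem i k))]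
    refine ⟨⟨c, C, hc, fun k => ?_⟩, fun f => ?_⟩
    · simp only [hk']; exact h _
    · simp only [hk']
      refine (hnull f).comp (StrictMono.tendsto_atTop fun k l hkl => ?_)
      have h1 := hm (rlIndex_lt_rlIndex (hmem i k) (hmem i l) (Or.inl (by simpa using hkl)))
      have h2 := hle _ (hmem i k)
      simp only [k'] at *
      omega
  · rintro _ ⟨j, hj, rfl⟩
    exact ⟨m (rlIndex (i, j)), hle (i, j) hj, rfl⟩
  · exact hm (rlIndex_lt_rlIndex hp hq h)

end

theorem theorem2p9 {𝕜 : Type*} [RCLike 𝕜] {X : Type*} [NormedAddCommGroup X] [NormedSpace 𝕜 X]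
    [CompleteSpace X] (x : ℕ × ℕ → X) (hx : IsRegularArray 𝕜 x)
    (M : ℕ → ℕ) (hM : Monotone M) (ε : ℝ) (hε : 0 < ε) :
    ∃ y : ℕ × ℕ → X, IsSubarray 𝕜 x y ∧ IsRegularArray 𝕜 y ∧
      ∀ a : ℕ × ℕ →₀ 𝕜, (∀ p ∈ a.support, p ∈ triIndex) →
      ∀ (k₀ : ℕ) (F : Finset ℕ) (hF : F.Nonempty), F.card ≤ M (F.min' hF) → k₀ ≤ F.min' hF →
        1 / (2 + ε) * ‖∑ j ∈ F, a (k₀, j) • y (k₀, j)‖ ≤ ‖a.sum fun p c => c • y p‖ := by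
  classical
  -- The bounds `c i` and `C i` of the norms depend on the row only, so they are known before any
  -- choice is made.
  choose c C hc hcC using fun i => (hx.1 i).1
  obtain ⟨η, hη, hη8, hηε⟩ : ∃ η : ℝ, 0 < η ∧ η ≤ 1 / 8 ∧ 36 * η ≤ ε :=
    ⟨min (1 / 8) (ε / 36), by positivity, min_le_left _ _, by
      have := min_le_right (1 / 8) (ε / 36); linarith⟩
  -- The second index is raised to `i + (l - i) = max i l`, so that it stays in the row.
  obtain ⟨m, hm, hinit, htree⟩ := exists_schreier_selection (𝕜 := 𝕜)
    (fun i l => x (i, i + (l - i))) (fun i f => ((hx.1 i).2 f).comp (tendsto_sub_atTop_nat i))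
    C (fun i l => (hcC i _).2) (fun n => (rlEnum n).1) (fun q => M (rlEnum q).2) c hc hη
  set y : ℕ × ℕ → X := fun p => x (p.1, m (rlIndex p)) with hy
  have hyn : ∀ n, x ((rlEnum n).1, (rlEnum n).1 + (m n - (rlEnum n).1)) = y (rlEnum n) := by
    intro n
    rw [Nat.add_sub_cancel' ((fst_rlEnum_le n).trans (hm.id_le n)), hy]
    simp only [rlIndex_rlEnum]
  have hcy : ∀ n, c (rlEnum n).1 ≤ ‖y (rlEnum n)‖ := fun n => hyn n ▸ (hcC _ _).1
  simp only [hyn] at hinit htree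
  have hsub : IsSubarray 𝕜 x y := isSubarray_of_strictMono hx.1 hm
  refine ⟨y, hsub, ⟨hsub.1, isBasicSequence_of_norm_sum_le _
    (fun n => norm_pos_iff.mp ((hc _).trans_le (hcy n))) (1 + 8 * η) fun a n => ?_⟩, ?_⟩
  · rw [linearCombination_eq_sum_range (N := max n (a.support.sup id + 1)) _ a fun i hi =>
      (lt_sup_support_add_one a i hi).trans_le (le_max_right _ _)]
    exact (norm_partial_sum_and_coeff_le (fun n => hc _) hcy hη hη8 hinit a _).1 n (le_max_left _ _)
  intro a ha k₀ F hF hFM hk₀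
  have htri : ∀ j ∈ F, (k₀, j) ∈ triIndex := fun j hj => hk₀.trans (F.min'_le j hj)
  set N := (a.support ∪ F.image fun j => (k₀, j)).sup rlIndex + 1 with hN
  have hlt : ∀ p ∈ a.support ∪ F.image fun j => (k₀, j), rlIndex p < N := fun p hp =>
    Nat.lt_succ_of_le (Finset.le_sup hp)
  have hltF : ∀ j ∈ F, rlIndex (k₀, j) < N := fun j hj =>
    hlt _ (Finset.mem_union_right _ (Finset.mem_image_of_mem _ hj))
  have hsum : (a.sum fun p c => c • y p) =
      ∑ n ∈ Finset.range N, a (rlEnum n) • y (rlEnum n) := by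
    rw [Finsupp.sum_of_support_subset a (s := (Finset.range N).image rlEnum) (fun p hp => ?_) _
      (by simp), Finset.sum_image rlEnum_injective.injOn]
    exact Finset.mem_image.mpr ⟨rlIndex p, by simpa using hlt p (Finset.mem_union_left _ hp),
      rlEnum_rlIndex (ha p hp)⟩
  have hinj : Set.InjOn (fun j => rlIndex (k₀, j)) F := fun i hi j hj h => by
    have := congrArg rlEnum h
    simp only [rlEnum_rlIndex (htri i hi), rlEnum_rlIndex (htri j hj)] at this
    exact (Prod.mk.inj this).2
  set P := F.image fun j => rlIndex (k₀, j) with hP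
  have hsumF : ∑ j ∈ F, a (k₀, j) • y (k₀, j) = ∑ n ∈ P, a (rlEnum n) • y (rlEnum n) := by
    rw [hP, Finset.sum_image hinj]
    exact Finset.sum_congr rfl fun j hj => by rw [rlEnum_rlIndex (htri j hj)]
  set q := rlIndex (k₀, F.min' hF) with hq
  have hqE : rlEnum q = (k₀, F.min' hF) := rlEnum_rlIndex (htri _ (F.min'_mem hF))
  have hPcard : P.card = F.card := Finset.card_image_of_injOn hinj
  have hPN : P ⊆ Finset.Ico q N := by
    intro p hp
    obtain ⟨j, hj, rfl⟩ := Finset.mem_image.mp hp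
    refine Finset.mem_Ico.mpr ⟨?_, hltF j hj⟩
    rcases (F.min'_le j hj).eq_or_lt with h | h
    · rw [hq, h]
    · exact (rlIndex_lt_rlIndex (htri _ (F.min'_mem hF)) (htri j hj) (Or.inl h)).le
  have hrow : ∀ p ∈ P, (rlEnum p).1 = (rlEnum q).1 := by
    intro p hp
    obtain ⟨j, hj, rfl⟩ := Finset.mem_image.mp hp
    rw [hqE, rlEnum_rlIndex (htri j hj)]
  have hmain := norm_sum_subset_le (fun n => hc (rlEnum n).1) hcy hη hη8 hinit
    (htree q P hrow (by rw [hPcard, hqE]; exact hFM)) (hltF _ (F.min'_mem hF)).le hPN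
    fun n => a (rlEnum n)
  rw [hsum, hsumF, one_div, inv_mul_le_iff₀ (by positivity)]
  exact hmain.trans (mul_le_mul_of_nonneg_right (by linarith) (norm_nonneg _))
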